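/- Let $k$ be a field, $d\ge 0$, and let $P=k[x_0,\dots,x_d]$ be standard graded with $P_+=(x_0,\dots,x_d)$. Let $g_1,\dots,g_n\in P$ be homogeneous elements such that $I=(g_1,\dots,g_n)$ is $P_+$-primary, i.e. $\sqrt{I}=P_+$. Consider the minimal graded free resolution $$0\longrightarrow F_{d+1}\longrightarrow F_d\longrightarrow\cdots\longrightarrow F_1\longrightarrow F_0=P\longrightarrow P/I\longrightarrow 0$$ of $P/I$, and write its last module as $F_{d+1}=\bigoplus_{i} P(-\alpha_{d,i})$. If $m\in\mathbb{N}$ is such that $P_m\subseteq I$, where $P_m$ is the space of homogeneous polynomials of degree $m$, then $\alpha_{d,i}\le m+d$ for all $i$. -/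

import Mathlib

/-- The irrelevant ideal `P_+ = (x_0, …, x_d)` of `P = k[x_0, …, x_d]`. -/
noncomputable def irrelevantIdeal (k : Type*) [Field k] (d : ℕ) : Ideal (MvPolynomial (Fin (d + 1)) k) :=
  Ideal.span (Set.range MvPolynomial.X)

/-- `p` lies in the degree `a` part of the `ℤ`-graded ring `k[x_0, …, x_d]`
(which is zero for `a < 0`): every monomial of `p` has total degree `a`. -/
def IsHomogeneousOfIntDegree {k : Type*} [Field k] {d : ℕ}
    (p : MvPolynomial (Fin (d + 1)) k) (a : ℤ) : Prop :=
  ∀ s ∈ p.support, (s.degree : ℤ) = a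

/-- A minimal graded free resolution
`⋯ → F_2 → F_1 → F_0 → P/I → 0` of the graded module `P/I` over `P = k[x_0, …, x_d]`, where
`F_j = ⨁_i P(-twist j i)` is free of finite rank. The `i`-th basis vector of `F_j` is homogeneous
of degree `twist j i`. No bound on the length is built in. -/
structure MinimalGradedFreeResolution {k : Type*} [Field k] {d : ℕ}
    (I : Ideal (MvPolynomial (Fin (d + 1)) k)) where
  /-- the rank of `F_j` -/
  rank : ℕ → ℕ
  /-- the twists (the degrees of the basis vectors of `F_j`) -/
  twist : (j : ℕ) → Fin (rank j) → ℤ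
  /-- the augmentation `F_0 → P/I` -/
  aug : (Fin (rank 0) → MvPolynomial (Fin (d + 1)) k) →ₗ[MvPolynomial (Fin (d + 1)) k]
    (MvPolynomial (Fin (d + 1)) k ⧸ I)
  /-- the differential `F_{j+1} → F_j` -/
  diff : (j : ℕ) → (Fin (rank (j + 1)) → MvPolynomial (Fin (d + 1)) k)
    →ₗ[MvPolynomial (Fin (d + 1)) k] (Fin (rank j) → MvPolynomial (Fin (d + 1)) k)
  /-- the augmentation preserves degrees -/
  aug_homogeneous : ∀ i, ∃ p : MvPolynomial (Fin (d + 1)) k,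
    IsHomogeneousOfIntDegree p (twist 0 i) ∧ aug (Pi.single i 1) = Ideal.Quotient.mk I p
  /-- the differentials preserve degrees -/
  diff_homogeneous : ∀ j i i',
    IsHomogeneousOfIntDegree (diff j (Pi.single i 1) i') (twist (j + 1) i - twist j i')
  aug_surjective : Function.Surjective aug
  exact_zero : Function.Exact (diff 0) aug
  exact_succ : ∀ j, Function.Exact (diff (j + 1)) (diff j)
  /-- minimality: `F_{j+1}` is mapped into `P_+ F_j` -/
  minimal : ∀ j v i', diff j v i' ∈ irrelevantIdeal k d

open MvPolynomial

universe u v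

/-! The double complex `F ⊗ K`, with `K` the Koszul complex on the variables, computes `Tor(P/I, k)`
in two ways. By minimality a basis vector of `F_{d+1}` of degree `α` is a nonzero Tor class. In `P/I
⊗ K`, elements of degree `α` have coefficients of degree at least `α - (d+1)`; if `α > m + d` this
is at least `m`, where `P/I` vanishes, so the class is zero.

The comparison is an explicit zigzag. From `z` over `F_q`, apply the differential of `F` and lift
the result along the Koszul differential by a degree-preserving homotopy
(`diff_homotopy_add_homotopy_diff`, `map_diff_eq_diff_homotopy`), down to `F_0`. There the
augmentation kills the lift, and exactness of `F` carries the conclusion back up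
(`exists_eq_map_diff_add_diff`). The basis vector then lies in `P_+ F_{d+1}`, which its coefficient
1 forbids. -/

/-- The underlying group of the Koszul complex on the variables in `l` with coefficients in `M`;
the two factors are the coefficients of the basis elements without and with the first variable. -/
def Koszul {σ : Type v} (M : Type u) : List σ → Type u
  | [] => M
  | _ :: l => Koszul M l × Koszul M l

namespace Koszul

variable {σ : Type v} {k : Type*} [Field k]

noncomputable instance instAddCommGroup (M : Type u) [AddCommGroup M] :
    (l : List σ) → AddCommGroup (Koszul M l)
  | [] => inferInstanceAs (AddCommGroup M)
  | _ :: l =>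
    letI := instAddCommGroup M l
    inferInstanceAs (AddCommGroup (Koszul M l × Koszul M l))

/-! ### Koszul complexes as functors of the coefficients. -/

section Functoriality

variable {M M' M'' : Type*} [AddCommGroup M] [AddCommGroup M'] [AddCommGroup M'']

/-- The map on Koszul complexes induced by a map of coefficients. -/
noncomputable def map (f : M →+ M') : (l : List σ) → Koszul M l →+ Koszul M' l
  | [] => f
  | _ :: l => AddMonoidHom.prodMap (map f l) (map f l)

theorem map_cons (f : M →+ M') (i : σ) (l : List σ) (a b : Koszul M l) :
    map f (i :: l) (a, b) = (map f l a, map f l b) := rfl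

/-- The inclusion of the coefficients as the part of homological degree zero. -/
noncomputable def incl : (l : List σ) → M →+ Koszul M l
  | [] => AddMonoidHom.id M
  | _ :: l => (AddMonoidHom.inl (Koszul M l) (Koszul M l)).comp (incl l)

/-- The projection to the part of homological degree zero. -/
noncomputable def bottom : (l : List σ) → Koszul M l →+ M
  | [] => AddMonoidHom.id M
  | _ :: l => (bottom l).comp (AddMonoidHom.fst (Koszul M l) (Koszul M l))

theorem incl_cons (i : σ) (l : List σ) (v : M) :
    incl (i :: l) v = (incl l v, (0 : Koszul M l)) := rfl

theorem bottom_cons (i : σ) (l : List σ) (a b : Koszul M l) :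
    bottom (i :: l) (a, b) = bottom l a := rfl

theorem bottom_incl (l : List σ) (v : M) : bottom l (incl l v) = v := by
  induction l with
  | nil => rfl
  | cons i l ih => exact ih

theorem bottom_map (f : M →+ M') (l : List σ) (z : Koszul M l) :
    bottom l (map f l z) = f (bottom l z) := by
  induction l with
  | nil => rfl
  | cons i l ih => exact ih z.1

/-- As a group, the Koszul complex is a finite direct sum of copies of the coefficients. -/
theorem map_exact {f : M →+ M'} {g : M' →+ M''} (h : Function.Exact f g) (l : List σ) :
    Function.Exact (map f l) (map g l) := by
  induction l with
  | nil => exact h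
  | cons i l ih =>
    rintro ⟨a, b⟩
    constructor
    · intro hz
      obtain ⟨u, rfl⟩ := (ih a).1 (congrArg Prod.fst hz)
      obtain ⟨w, rfl⟩ := (ih b).1 (congrArg Prod.snd hz)
      exact ⟨(u, w), rfl⟩
    · rintro ⟨⟨u, w⟩, hz⟩
      exact Prod.ext ((ih a).2 ⟨u, congrArg Prod.fst hz⟩) ((ih b).2 ⟨w, congrArg Prod.snd hz⟩)

end Functoriality

/-! ### The Koszul differential, as an iterated mapping cone of multiplication by variables. -/

section Differential

variable {M M' : Type*} [AddCommGroup M] [AddCommGroup M']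
  [Module (MvPolynomial σ k) M] [Module (MvPolynomial σ k) M']

variable (k) in
/-- Multiplication by the `i`-th variable on the Koszul complex. -/
noncomputable def mulX (M : Type*) [AddCommGroup M] [Module (MvPolynomial σ k) M]
    (i : σ) (l : List σ) : Koszul M l →+ Koszul M l :=
  map (DistribSMul.toAddMonoidHom M (X i : MvPolynomial σ k)) l

variable (k) in
/-- The Koszul differential. -/
noncomputable def diff (M : Type*) [AddCommGroup M] [Module (MvPolynomial σ k) M] :
    (l : List σ) → Koszul M l →+ Koszul M l
  | [] => 0
  | i :: l =>
    ((diff M l).comp (AddMonoidHom.fst (Koszul M l) (Koszul M l)) +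
      (mulX k M i l).comp (AddMonoidHom.snd (Koszul M l) (Koszul M l))).prod
      (-(diff M l).comp (AddMonoidHom.snd (Koszul M l) (Koszul M l)))

theorem diff_cons (i : σ) (l : List σ) (a b : Koszul M l) :
    diff k M (i :: l) (a, b) = (diff k M l a + mulX k M i l b, -diff k M l b) := rfl

theorem diff_incl (l : List σ) (v : M) : diff k M l (incl l v) = 0 := by
  induction l with
  | nil => rfl
  | cons i l ih => rw [incl_cons, diff_cons, ih, map_zero, map_zero, neg_zero, add_zero]; rfl

theorem map_comp_apply {M₁ M₂ M₃ : Type*} [AddCommGroup M₁] [AddCommGroup M₂] [AddCommGroup M₃]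
    (g : M₂ →+ M₃) (f : M₁ →+ M₂) (l : List σ) (z : Koszul M₁ l) :
    map g l (map f l z) = map (g.comp f) l z := by
  induction l with
  | nil => rfl
  | cons i l ih => exact Prod.ext (ih z.1) (ih z.2)

theorem map_mulX (f : M →+ M') {i : σ}
    (hf : ∀ v, f ((X i : MvPolynomial σ k) • v) = (X i : MvPolynomial σ k) • f v)
    (l : List σ) (z : Koszul M l) :
    map f l (mulX k M i l z) = mulX k M' i l (map f l z) := by
  rw [mulX, mulX, map_comp_apply, map_comp_apply]
  congr 2
  ext v
  exact hf v

theorem map_diff (f : M →+ M') (l : List σ)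
    (hf : ∀ i ∈ l, ∀ v, f ((X i : MvPolynomial σ k) • v) = (X i : MvPolynomial σ k) • f v)
    (z : Koszul M l) : map f l (diff k M l z) = diff k M' l (map f l z) := by
  induction l with
  | nil => exact map_zero f
  | cons i l ih =>
    obtain ⟨a, b⟩ := z
    have ih := ih (fun j hj ↦ hf j (List.mem_cons_of_mem i hj))
    rw [diff_cons, map_cons, map_cons, diff_cons, map_add, map_neg, ih, ih,
      map_mulX f (hf i List.mem_cons_self)]

theorem diff_diff (l : List σ) (z : Koszul M l) : diff k M l (diff k M l z) = 0 := by
  induction l with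
  | nil => rfl
  | cons i l ih =>
    obtain ⟨a, b⟩ := z
    have hcomm : mulX k M i l (diff k M l b) = diff k M l (mulX k M i l b) :=
      map_diff (DistribSMul.toAddMonoidHom M (X i : MvPolynomial σ k)) l
        (fun j _ v ↦ smul_comm (X i : MvPolynomial σ k) (X j : MvPolynomial σ k) v) b
    rw [diff_cons, diff_cons, map_add, map_neg, map_neg, ih, ih, hcomm, zero_add, add_neg_cancel]
    exact Prod.ext rfl (neg_neg (0 : Koszul M l))

/-- Applied with `N = P_+ M`: Koszul boundaries in homological degree zero are combinations of
multiples of the variables. -/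
theorem bottom_diff_mem (N : Submodule (MvPolynomial σ k) M)
    (hN : ∀ (i : σ) (v : M), (X i : MvPolynomial σ k) • v ∈ N) (l : List σ) (z : Koszul M l) :
    bottom l (diff k M l z) ∈ N := by
  induction l with
  | nil => exact N.zero_mem
  | cons i l ih =>
    obtain ⟨a, b⟩ := z
    rw [diff_cons, bottom_cons, map_add, mulX, bottom_map]
    exact N.add_mem (ih a) (hN i _)

end Differential

/-! ### Contraction of the Koszul complex of a free module. -/

section Homotopy

variable {ι : Type*}

/-- Coordinatewise division by a variable. -/
noncomputable def divX (i : σ) : (ι → MvPolynomial σ k) →+ (ι → MvPolynomial σ k) where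
  toFun v t := (v t).divMonomial (Finsupp.single i 1)
  map_zero' := by ext1; simp
  map_add' v w := by ext1; simp [add_divMonomial]

/-- Coordinatewise substitution of zero for a variable. -/
noncomputable def modX (i : σ) : (ι → MvPolynomial σ k) →+ (ι → MvPolynomial σ k) :=
  AddMonoidHom.id _ - (DistribSMul.toAddMonoidHom _ (X i : MvPolynomial σ k)).comp (divX i)

theorem modX_apply (i : σ) (v : ι → MvPolynomial σ k) :
    modX i v = v - (X i : MvPolynomial σ k) • divX i v := rfl

theorem divX_X_smul (i : σ) (v : ι → MvPolynomial σ k) :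
    divX i ((X i : MvPolynomial σ k) • v) = v := by
  ext1 t
  exact X_mul_divMonomial i (v t)

theorem divX_X_smul_of_ne {i j : σ} (h : i ≠ j) (v : ι → MvPolynomial σ k) :
    divX i ((X j : MvPolynomial σ k) • v) = (X j : MvPolynomial σ k) • divX i v := by
  classical
  ext t s
  simp only [divX, AddMonoidHom.coe_mk, ZeroHom.coe_mk, Pi.smul_apply, smul_eq_mul,
    coeff_divMonomial, coeff_X_mul', Finsupp.mem_support_iff, Finsupp.add_apply,
    Finsupp.single_eq_of_ne h.symm, zero_add]
  split_ifs with hs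
  · congr 1
    ext a
    by_cases ha : a = j
    · subst ha; simp [Finsupp.single_eq_of_ne h.symm]
    · simp [Finsupp.single_eq_of_ne ha]
  · rfl

theorem modX_X_smul (i : σ) (v : ι → MvPolynomial σ k) :
    modX i ((X i : MvPolynomial σ k) • v) = 0 := by
  rw [modX_apply, divX_X_smul, sub_self]

theorem modX_X_smul_of_ne {i j : σ} (h : i ≠ j) (v : ι → MvPolynomial σ k) :
    modX i ((X j : MvPolynomial σ k) • v) = (X j : MvPolynomial σ k) • modX i v := by
  rw [modX_apply, modX_apply, divX_X_smul_of_ne h, smul_sub, smul_comm]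

/-- Coordinatewise substitution of zero for all variables in a list. -/
noncomputable def modXs : (l : List σ) → (ι → MvPolynomial σ k) →+ (ι → MvPolynomial σ k)
  | [] => AddMonoidHom.id _
  | i :: l => (modXs l).comp (modX i)

/-- The contracting homotopy of the Koszul complex of a free module. -/
noncomputable def homotopy : (l : List σ) →
    Koszul (ι → MvPolynomial σ k) l →+ Koszul (ι → MvPolynomial σ k) l
  | [] => 0
  | i :: l => (((homotopy l).comp (map (modX i) l)).prod (map (divX i) l)).comp
      (AddMonoidHom.fst (Koszul (ι → MvPolynomial σ k) l) (Koszul (ι → MvPolynomial σ k) l))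

theorem homotopy_cons (i : σ) (l : List σ) (a b : Koszul (ι → MvPolynomial σ k) l) :
    homotopy (i :: l) (a, b) = (homotopy l (map (modX i) l a), map (divX i) l a) := rfl

theorem map_id_apply {M : Type*} [AddCommGroup M] (l : List σ) (z : Koszul M l) :
    map (AddMonoidHom.id M) l z = z := by
  induction l with
  | nil => rfl
  | cons i l ih => exact Prod.ext (ih z.1) (ih z.2)

theorem map_zero_apply {M M' : Type*} [AddCommGroup M] [AddCommGroup M'] (l : List σ)
    (z : Koszul M l) : map (0 : M →+ M') l z = 0 := by
  induction l with
  | nil => rfl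
  | cons i l ih => exact Prod.ext (ih z.1) (ih z.2)

theorem map_sub_apply {M M' : Type*} [AddCommGroup M] [AddCommGroup M'] (f g : M →+ M')
    (l : List σ) (z : Koszul M l) : map (f - g) l z = map f l z - map g l z := by
  induction l with
  | nil => rfl
  | cons i l ih => exact Prod.ext (ih z.1) (ih z.2)

/-- For one variable this is the splitting `v = x_i • divX i v + modX i v`. The inductive step needs
`divX i` and `modX i` to commute with the remaining differential, hence distinct variables. Only
constant terms in homological degree zero survive once `l` contains every variable. -/
theorem diff_homotopy_add_homotopy_diff (l : List σ) (hl : l.Nodup)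
    (z : Koszul (ι → MvPolynomial σ k) l) :
    diff k _ l (homotopy l z) + homotopy l (diff k _ l z) = z - incl l (modXs l (bottom l z)) := by
  induction l with
  | nil => exact (add_zero _).trans (sub_self z).symm
  | cons i l ih =>
    obtain ⟨a, b⟩ := z
    obtain ⟨hi, hl⟩ := List.nodup_cons.1 hl
    have hne : ∀ j ∈ l, i ≠ j := fun j hj h ↦ hi (h ▸ hj)
    have hdiv : map (divX i) l (mulX k _ i l b) = b := by
      rw [mulX, map_comp_apply]
      exact (congrArg (fun f ↦ map f l b) (AddMonoidHom.ext (divX_X_smul i))).trans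
        (map_id_apply l b)
    have hmod : map (modX i) l (mulX k _ i l b) = 0 := by
      rw [mulX, map_comp_apply]
      exact (congrArg (fun f ↦ map f l b) (AddMonoidHom.ext (modX_X_smul i))).trans
        (map_zero_apply l b)
    have hX : mulX k _ i l (map (divX i) l a) = a - map (modX i) l a := by
      rw [modX, map_sub_apply, map_id_apply, mulX, map_comp_apply, sub_sub_cancel]
    have ih := ih hl (map (modX i) l a)
    rw [bottom_map] at ih
    rw [diff_cons, homotopy_cons, homotopy_cons, diff_cons, map_add, map_add (map (divX i) l),
      hdiv, hmod, hX, map_diff (divX i) l (fun j hj ↦ divX_X_smul_of_ne (hne j hj)),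
      map_diff (modX i) l (fun j hj ↦ modX_X_smul_of_ne (hne j hj)), bottom_cons, incl_cons]
    refine Prod.ext ?_ ?_
    · change diff k _ l (homotopy l (map (modX i) l a)) + (a - map (modX i) l a) +
        homotopy l (diff k _ l (map (modX i) l a) + 0) =
        a - incl l (modXs l (modX i (bottom l a)))
      rw [eq_sub_iff_add_eq] at ih ⊢
      rw [add_zero]
      calc _ = (diff k _ l (homotopy l (map (modX i) l a)) +
            homotopy l (diff k _ l (map (modX i) l a)) +
            incl l (modXs l (modX i (bottom l a)))) + (a - map (modX i) l a) := by abel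
        _ = a := by rw [ih]; abel
    · change -diff k _ l (map (divX i) l a) + (diff k _ l (map (divX i) l a) + b) = b - 0
      abel

theorem coeff_modX (i : σ) (v : ι → MvPolynomial σ k) (t : ι) (s : σ →₀ ℕ) :
    coeff s (modX i v t) = if s i = 0 then coeff s (v t) else 0 := by
  classical
  have h : modX i v t = v t - X i * (v t).divMonomial (Finsupp.single i 1) := rfl
  rw [h, coeff_sub, coeff_X_mul', coeff_divMonomial]
  by_cases hs : s i = 0
  · simp [hs]
  · have hle : Finsupp.single i 1 ≤ s := by
      rw [Finsupp.single_le_iff]; omega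
    simp [hs, add_tsub_cancel_of_le hle]

theorem coeff_modXs (l : List σ) (v : ι → MvPolynomial σ k) (t : ι) (s : σ →₀ ℕ) :
    coeff s (modXs l v t) = if ∀ i ∈ l, s i = 0 then coeff s (v t) else 0 := by
  classical
  induction l generalizing v with
  | nil => simp [modXs]
  | cons i l ih =>
    have h : modXs (i :: l) v = modXs l (modX i v) := rfl
    rw [h, ih, coeff_modX]
    simp only [List.forall_mem_cons]
    split_ifs <;> tauto

theorem modXs_eq_zero (l : List σ) (hl : ∀ i, i ∈ l) (v : ι → MvPolynomial σ k)
    (hv : ∀ t, coeff 0 (v t) = 0) : modXs l v = 0 := by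
  ext t s
  rw [coeff_modXs]
  split_ifs with h
  · obtain rfl : s = 0 := Finsupp.ext fun i ↦ h i (hl i)
    simpa using hv t
  · simp

end Homotopy

/-! ### Internal degrees on the Koszul complex. -/

section Degree

variable {M M' : Type*} [AddCommGroup M] [AddCommGroup M']

/-- Homogeneous elements of the Koszul complex, for the total internal degree in which the basis
element corresponding to a set of variables has the cardinality of the set as its degree. -/
def IsHomogeneous (G : ℤ → M → Prop) : (l : List σ) → ℤ → Koszul M l → Prop
  | [], δ, z => G δ z
  | _ :: l, δ, z => IsHomogeneous G l δ z.1 ∧ IsHomogeneous G l (δ - 1) z.2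

theorem IsHomogeneous.map {G : ℤ → M → Prop} {G' : ℤ → M' → Prop} (f : M →+ M') (c : ℤ)
    (hf : ∀ δ v, G δ v → G' (δ + c) (f v)) {l : List σ} {δ : ℤ} {z : Koszul M l}
    (hz : IsHomogeneous G l δ z) : IsHomogeneous G' l (δ + c) (Koszul.map f l z) := by
  induction l generalizing δ with
  | nil => exact hf δ z hz
  | cons i l ih =>
    have h := ih hz.2
    rw [sub_add_eq_add_sub] at h
    exact ⟨ih hz.1, h⟩

theorem IsHomogeneous.zero {G : ℤ → M → Prop} (hG : ∀ δ, G δ 0) (l : List σ) (δ : ℤ) :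
    IsHomogeneous G l δ 0 := by
  induction l generalizing δ with
  | nil => exact hG δ
  | cons i l ih => exact ⟨ih δ, ih (δ - 1)⟩

theorem IsHomogeneous.incl {G : ℤ → M → Prop} (hG : ∀ δ, G δ 0) (l : List σ) {δ : ℤ} {v : M}
    (hv : G δ v) : IsHomogeneous G l δ (Koszul.incl l v) := by
  induction l with
  | nil => exact hv
  | cons i l ih => exact ⟨ih, IsHomogeneous.zero hG l (δ - 1)⟩

theorem IsHomogeneous.eq_zero {G : ℤ → M → Prop} {m : ℤ} (hG : ∀ δ v, m ≤ δ → G δ v → v = 0)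
    {l : List σ} {δ : ℤ} (hδ : m + l.length ≤ δ) {z : Koszul M l} (hz : IsHomogeneous G l δ z) :
    z = 0 := by
  induction l generalizing δ with
  | nil => exact hG δ z (by simpa using hδ) hz
  | cons i l ih =>
    rw [List.length_cons] at hδ
    push_cast at hδ
    exact Prod.ext (ih (by linarith) hz.1) (ih (by linarith) hz.2)

theorem IsHomogeneous.homotopy {ι : Type*} {G : ℤ → (ι → MvPolynomial σ k) → Prop}
    (hG : ∀ δ, G δ 0) (hdiv : ∀ i δ v, G δ v → G (δ - 1) (divX i v))
    (hmod : ∀ i δ v, G δ v → G δ (modX i v)) {l : List σ} {δ : ℤ}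
    {z : Koszul (ι → MvPolynomial σ k) l} (hz : IsHomogeneous G l δ z) :
    IsHomogeneous G l δ (Koszul.homotopy l z) := by
  induction l generalizing δ with
  | nil => exact hG δ
  | cons i l ih =>
    -- The degree lost in dividing by `x_i` is regained from the basis element of `x_i`.
    refine ⟨ih ?_, IsHomogeneous.map (divX i) (-1) (hdiv i) hz.1⟩
    have h := IsHomogeneous.map (G' := G) (modX i) 0
      (fun δ v hv ↦ by simpa using hmod i δ v hv) hz.1
    rwa [add_zero] at h

end Degree

end Koszul

/-! ### Polynomials homogeneous of integer degree. -/

section IntDegree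

variable {k : Type*} [Field k] {d : ℕ} {p q : MvPolynomial (Fin (d + 1)) k} {a b : ℤ}

theorem isHomogeneousOfIntDegree_iff :
    IsHomogeneousOfIntDegree p a ↔ ∀ s, coeff s p ≠ 0 → (s.degree : ℤ) = a := by
  simp [IsHomogeneousOfIntDegree]

theorem IsHomogeneousOfIntDegree.zero (a : ℤ) :
    IsHomogeneousOfIntDegree (0 : MvPolynomial (Fin (d + 1)) k) a := by
  simp [IsHomogeneousOfIntDegree]

theorem IsHomogeneousOfIntDegree.add (hp : IsHomogeneousOfIntDegree p a)
    (hq : IsHomogeneousOfIntDegree q a) : IsHomogeneousOfIntDegree (p + q) a := by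
  intro s hs
  rcases Finset.mem_union.1 (support_add hs) with h | h
  · exact hp s h
  · exact hq s h

theorem IsHomogeneousOfIntDegree.sum {ι : Type*} {t : Finset ι}
    {f : ι → MvPolynomial (Fin (d + 1)) k} (h : ∀ i ∈ t, IsHomogeneousOfIntDegree (f i) a) :
    IsHomogeneousOfIntDegree (∑ i ∈ t, f i) a :=
  Finset.sum_induction f (IsHomogeneousOfIntDegree · a) (fun _ _ ↦ .add) (.zero a) h

theorem IsHomogeneousOfIntDegree.mul (hp : IsHomogeneousOfIntDegree p a)
    (hq : IsHomogeneousOfIntDegree q b) : IsHomogeneousOfIntDegree (p * q) (a + b) := by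
  classical
  intro s hs
  obtain ⟨u, hu, w, hw, rfl⟩ := Finset.mem_add.1 (support_mul p q hs)
  rw [map_add, Nat.cast_add, hp u hu, hq w hw]

theorem IsHomogeneousOfIntDegree.divX {ι : Type*} (i : Fin (d + 1))
    {v : ι → MvPolynomial (Fin (d + 1)) k} {t : ι} (hv : IsHomogeneousOfIntDegree (v t) a) :
    IsHomogeneousOfIntDegree (Koszul.divX i v t) (a - 1) := by
  rw [isHomogeneousOfIntDegree_iff] at hv ⊢
  intro s hs
  have h := hv (Finsupp.single i 1 + s) (by simpa [Koszul.divX, coeff_divMonomial] using hs)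
  rw [map_add, Finsupp.degree_single] at h
  push_cast at h
  linarith

theorem IsHomogeneousOfIntDegree.modX {ι : Type*} (i : Fin (d + 1))
    {v : ι → MvPolynomial (Fin (d + 1)) k} {t : ι} (hv : IsHomogeneousOfIntDegree (v t) a) :
    IsHomogeneousOfIntDegree (Koszul.modX i v t) a := by
  rw [isHomogeneousOfIntDegree_iff] at hv ⊢
  intro s hs
  rw [Koszul.coeff_modX] at hs
  exact hv s fun h ↦ hs (by simp [h])

/-- Every monomial of degree at least `m` is a multiple of one of degree `m`. -/
theorem IsHomogeneousOfIntDegree.mem_ideal {I : Ideal (MvPolynomial (Fin (d + 1)) k)} {m : ℕ}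
    (hI : ∀ p : MvPolynomial (Fin (d + 1)) k, p.IsHomogeneous m → p ∈ I)
    (hp : IsHomogeneousOfIntDegree p a) (ha : (m : ℤ) ≤ a) : p ∈ I := by
  rw [p.as_sum]
  refine I.sum_mem fun s hs ↦ ?_
  have hms : m ≤ s.degree := by exact_mod_cast ha.trans_eq (hp s hs).symm
  obtain ⟨u, hus, hu⟩ := Finsupp.exists_le_degree_eq s m hms
  have h : monomial s (coeff s p) = monomial (s - u) (coeff s p) * monomial u 1 := by
    rw [monomial_mul, tsub_add_cancel_of_le hus, mul_one]
  rw [h]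
  exact I.mul_mem_left _ (hI _ (isHomogeneous_monomial 1 hu))

end IntDegree

theorem coeff_zero_of_mem_irrelevantIdeal {k : Type*} [Field k] {d : ℕ}
    {p : MvPolynomial (Fin (d + 1)) k} (hp : p ∈ irrelevantIdeal k d) : coeff 0 p = 0 := by
  have h : irrelevantIdeal k d ≤ RingHom.ker (constantCoeff (R := k) (σ := Fin (d + 1))) := by
    rw [irrelevantIdeal, Ideal.span_le]
    rintro _ ⟨i, rfl⟩
    simp
  exact h hp

theorem apply_eq_sum_smul_single {R M ι : Type*} [CommRing R] [AddCommGroup M] [Module R M]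
    [Fintype ι] [DecidableEq ι] (f : (ι → R) →ₗ[R] M) (v : ι → R) :
    f v = ∑ i, v i • f (Pi.single i 1) := by
  conv_lhs => rw [pi_eq_sum_univ' v, map_sum]
  simp only [map_smul]

/-! ### The zigzag between the resolution and the Koszul complex. -/

namespace MinimalGradedFreeResolution

variable {k : Type*} [Field k] {d : ℕ} {I : Ideal (MvPolynomial (Fin (d + 1)) k)}
  (F : MinimalGradedFreeResolution I)

/-- `v` is a homogeneous element of degree `δ` of the `j`-th module of the resolution. -/
def IsHomogeneousElem (j : ℕ) (δ : ℤ) (v : Fin (F.rank j) → MvPolynomial (Fin (d + 1)) k) : Prop :=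
  ∀ t, IsHomogeneousOfIntDegree (v t) (δ - F.twist j t)

theorem isHomogeneousElem_zero (j : ℕ) (δ : ℤ) : F.IsHomogeneousElem j δ 0 :=
  fun _ ↦ .zero _

theorem isHomogeneousElem_single (j : ℕ) (i : Fin (F.rank j)) :
    F.IsHomogeneousElem j (F.twist j i) (Pi.single i 1) := by
  intro t
  rcases eq_or_ne t i with rfl | h
  · rw [Pi.single_eq_same, sub_self, isHomogeneousOfIntDegree_iff]
    intro s hs
    rw [coeff_one] at hs
    obtain rfl : 0 = s := by by_contra h; simp [h] at hs
    simp
  · rw [Pi.single_eq_of_ne h]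
    exact .zero _

theorem isHomogeneousElem_diff {j : ℕ} {δ : ℤ}
    {v : Fin (F.rank (j + 1)) → MvPolynomial (Fin (d + 1)) k}
    (hv : F.IsHomogeneousElem (j + 1) δ v) : F.IsHomogeneousElem j δ (F.diff j v) := by
  intro t
  rw [apply_eq_sum_smul_single, Finset.sum_apply]
  refine .sum fun i _ ↦ ?_
  have h := (hv i).mul (F.diff_homogeneous j i t)
  rw [sub_add_sub_cancel] at h
  exact h

theorem aug_eq_zero {m : ℕ} (hI : ∀ p : MvPolynomial (Fin (d + 1)) k, p.IsHomogeneous m → p ∈ I)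
    {δ : ℤ} (hδ : m ≤ δ) {v : Fin (F.rank 0) → MvPolynomial (Fin (d + 1)) k}
    (hv : F.IsHomogeneousElem 0 δ v) : F.aug v = 0 := by
  rw [apply_eq_sum_smul_single]
  refine Finset.sum_eq_zero fun i _ ↦ ?_
  obtain ⟨p, hp, h⟩ := F.aug_homogeneous i
  have hvp := (hv i).mul hp
  rw [sub_add_cancel] at hvp
  rw [h]
  exact Ideal.Quotient.eq_zero_iff_mem.2 (hvp.mem_ideal hI hδ)

/-- Minimality removes the constant terms that obstruct the contraction, so a Koszul cycle in the
image of the differential of `F` is a Koszul boundary. -/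
theorem map_diff_eq_diff_homotopy {l : List (Fin (d + 1))} (hl : l.Nodup) (hl' : ∀ i, i ∈ l)
    (q : ℕ) (z : Koszul (Fin (F.rank (q + 1)) → MvPolynomial (Fin (d + 1)) k) l)
    (hz : Koszul.diff k _ l (Koszul.map (F.diff q).toAddMonoidHom l z) = 0) :
    Koszul.map (F.diff q).toAddMonoidHom l z =
      Koszul.diff k _ l (Koszul.homotopy l (Koszul.map (F.diff q).toAddMonoidHom l z)) := by
  have h := Koszul.diff_homotopy_add_homotopy_diff l hl
    (Koszul.map (F.diff q).toAddMonoidHom l z)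
  have hmin := Koszul.modXs_eq_zero l hl' ((F.diff q).toAddMonoidHom (Koszul.bottom l z))
    (fun t ↦ coeff_zero_of_mem_irrelevantIdeal (F.minimal q _ t))
  rw [hz, Koszul.bottom_map, hmin, map_zero, map_zero, add_zero, sub_zero] at h
  exact h.symm

/-- In the tensor product of the resolution with the Koszul complex, an element of large degree
whose Koszul differential comes from the resolution is itself a sum of boundaries. -/
theorem exists_eq_map_diff_add_diff {m : ℕ}
    (hI : ∀ p : MvPolynomial (Fin (d + 1)) k, p.IsHomogeneous m → p ∈ I)
    {l : List (Fin (d + 1))} (hl : l.Nodup) (hl' : ∀ i, i ∈ l) {δ : ℤ} (hδ : m + l.length ≤ δ)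
    (q : ℕ) (z : Koszul (Fin (F.rank q) → MvPolynomial (Fin (d + 1)) k) l)
    (hz : Koszul.IsHomogeneous (F.IsHomogeneousElem q) l δ z)
    (hdz : ∃ u, Koszul.diff k _ l z = Koszul.map (F.diff q).toAddMonoidHom l u) :
    ∃ w w', z = Koszul.map (F.diff q).toAddMonoidHom l w + Koszul.diff k _ l w' := by
  induction q with
  | zero =>
    have h : Koszul.map F.aug.toAddMonoidHom l z = 0 := by
      -- This choice of `G` records the vanishing of `P/I` in degrees at least `m`, without a
      -- grading on the quotient.
      refine Koszul.IsHomogeneous.eq_zero (m := m) (G := fun δ v ↦ m ≤ δ → v = 0)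
        (fun δ v h hv ↦ hv h) hδ ?_
      simpa using hz.map (G' := fun δ v ↦ m ≤ δ → v = 0) F.aug.toAddMonoidHom 0
        (fun δ v hv h ↦ F.aug_eq_zero hI (by simpa using h) hv)
    obtain ⟨w, hw⟩ := (Koszul.map_exact (f := (F.diff 0).toAddMonoidHom)
      (g := F.aug.toAddMonoidHom) F.exact_zero l z).1 h
    exact ⟨w, 0, by rw [map_zero, add_zero, hw]⟩
  | succ q ih =>
    have hex := Koszul.map_exact (f := (F.diff (q + 1)).toAddMonoidHom)
      (g := (F.diff q).toAddMonoidHom) (F.exact_succ q) l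
    have hcomm := Koszul.map_diff (F.diff q).toAddMonoidHom l
      (fun i _ v ↦ (F.diff q).map_smul (X i) v)
    obtain ⟨u, hu⟩ := hdz
    have hcycle : Koszul.diff k _ l (Koszul.map (F.diff q).toAddMonoidHom l z) = 0 := by
      rw [← hcomm, hu]
      exact (hex _).2 ⟨u, rfl⟩
    have hy := F.map_diff_eq_diff_homotopy hl hl' q z hcycle
    have hdeg : Koszul.IsHomogeneous (F.IsHomogeneousElem q) l δ
        (Koszul.map (F.diff q).toAddMonoidHom l z) := by
      simpa using hz.map (G' := F.IsHomogeneousElem q) (F.diff q).toAddMonoidHom 0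
        (fun δ v hv ↦ by simpa using F.isHomogeneousElem_diff hv)
    -- The induction hypothesis applies to the homotopy lift of the image of `z`, whose Koszul
    -- differential is that image.
    obtain ⟨w, w', hw⟩ := ih _ (hdeg.homotopy (F.isHomogeneousElem_zero q)
      (fun i δ v hv t ↦ by simpa [sub_right_comm] using (hv t).divX i)
      (fun i δ v hv t ↦ (hv t).modX i)) ⟨z, hy.symm⟩
    -- Applying the Koszul differential to `hw` removes `w'`, so `z` and the Koszul boundary of `w`
    -- have the same image.
    have hker : Koszul.map (F.diff q).toAddMonoidHom l (z - Koszul.diff k _ l w) = 0 := by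
      have hww : Koszul.diff k _ l (Koszul.diff k _ l w') = 0 := Koszul.diff_diff l w'
      rw [map_sub, hcomm, hy, hw, map_add, hww, add_zero, sub_self]
    obtain ⟨x, hx⟩ := (hex _).1 hker
    exact ⟨x, w, by rw [hx, sub_add_cancel]⟩

end MinimalGradedFreeResolution

theorem lemma3p2 {k : Type*} [Field k] (d n m : ℕ)
    (g : Fin n → MvPolynomial (Fin (d + 1)) k)
    (hg : ∀ i, ∃ e : ℕ, (g i).IsHomogeneous e)
    (hprim : (Ideal.span (Set.range g)).radical = irrelevantIdeal k d)
    (hm : ∀ p : MvPolynomial (Fin (d + 1)) k, p.IsHomogeneous m → p ∈ Ideal.span (Set.range g))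
    (F : MinimalGradedFreeResolution (Ideal.span (Set.range g)))
    (i : Fin (F.rank (d + 1))) :
    F.twist (d + 1) i ≤ (m : ℤ) + d := by
  by_contra! hlt
  set l := List.finRange (d + 1)
  -- For integers, exceeding `m + d` means being at least `m + (d + 1)`, and `d + 1` is the length
  -- of `l`.
  obtain ⟨w, w', h⟩ := F.exists_eq_map_diff_add_diff hm (l := l) (List.nodup_finRange _)
    List.mem_finRange (δ := F.twist (d + 1) i) (by simp [l]; linarith) (d + 1)
    (Koszul.incl l (Pi.single i 1))
    (Koszul.IsHomogeneous.incl (F.isHomogeneousElem_zero _) l (F.isHomogeneousElem_single _ i))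
    ⟨0, by rw [Koszul.diff_incl, map_zero]⟩
  let N := Submodule.pi Set.univ fun _ : Fin (F.rank (d + 1)) ↦ irrelevantIdeal k d
  have hmem : Koszul.bottom l (Koszul.incl l (Pi.single i 1)) ∈ N := by
    -- The first summand lies in `P_+ F_{d+1}` by minimality, the second as a Koszul boundary.
    rw [h, map_add, Koszul.bottom_map]
    refine N.add_mem (fun t _ ↦ F.minimal _ _ t) (Koszul.bottom_diff_mem N (fun j v t _ ↦ ?_) l w')
    exact Ideal.mul_mem_right _ _ (Ideal.subset_span ⟨j, rfl⟩)
  rw [Koszul.bottom_incl] at hmem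
  have h1 := coeff_zero_of_mem_irrelevantIdeal (hmem i (Set.mem_univ i))
  simp at h1
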